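/- Let $G$ be a complex reductive group, $P\subset G$ a parabolic subgroup, $H$ a Levi subgroup of $P$, and $U^+$ the unipotent radical of $P$. For an algebraic group $K$ write $K^0$ for its identity component, and let $Z_G(h)$ be the centralizer of $h$ in $G$. If $h\in H$ satisfies $Z_G(h)^0\subset H$, then the map $$U^+\to U^+,\qquad u\mapsto (h^{-1}u^{-1}h)\,u,$$ is an isomorphism of varieties. In particular, for every $u'\in U^+$ there exists a unique $u\in U^+$ such that $hu'=u^{-1}hu$. -/

import Mathlib

/-! Complex linear algebraic groups, realized as Zariski closed subgroups of `GL n ℂ`.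
They need not be connected. -/

namespace LinAlgGroup

open Matrix

/-- A subset of `GL n ℂ` is Zariski closed if it is the set of common zeros in `GL n ℂ` of a
family of polynomials in the matrix entries. -/
def IsZariskiClosed {n : ℕ} (S : Set (GL (Fin n) ℂ)) : Prop :=
  ∃ I : Set (MvPolynomial (Fin n × Fin n) ℂ),
    S = {g : GL (Fin n) ℂ | ∀ p ∈ I,
      MvPolynomial.eval (fun k => (g : Matrix (Fin n) (Fin n) ℂ) k.1 k.2) p = 0}

theorem isZariskiClosed_empty {n : ℕ} : IsZariskiClosed (∅ : Set (GL (Fin n) ℂ)) :=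
  ⟨{1}, by ext g; simp⟩

theorem IsZariskiClosed.sInter {n : ℕ} {A : Set (Set (GL (Fin n) ℂ))}
    (hA : ∀ S ∈ A, IsZariskiClosed S) : IsZariskiClosed (⋂₀ A) := by
  choose! I hI using hA
  refine ⟨⋃ S ∈ A, I S, ?_⟩
  ext g
  simp only [Set.mem_sInter, Set.mem_iUnion, Set.mem_ofPred_eq]
  constructor
  · rintro h p ⟨S, hS, hp⟩
    have hg := h S hS
    rw [hI S hS] at hg
    exact hg p hp
  · intro h S hS
    rw [hI S hS]
    exact fun p hp => h p ⟨S, hS, hp⟩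

theorem IsZariskiClosed.union {n : ℕ} {S T : Set (GL (Fin n) ℂ)}
    (hS : IsZariskiClosed S) (hT : IsZariskiClosed T) : IsZariskiClosed (S ∪ T) := by
  obtain ⟨I, rfl⟩ := hS
  obtain ⟨J, rfl⟩ := hT
  refine ⟨{r | ∃ p ∈ I, ∃ q ∈ J, r = p * q}, ?_⟩
  ext g
  simp only [Set.mem_union, Set.mem_ofPred_eq]
  constructor
  · rintro (h | h) r ⟨p, hp, q, hq, rfl⟩
    · rw [map_mul, h p hp, zero_mul]
    · rw [map_mul, h q hq, mul_zero]
  · intro h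
    by_contra! hc
    obtain ⟨⟨p, hp, hp0⟩, ⟨q, hq, hq0⟩⟩ := hc
    have hpq := h _ ⟨p, hp, q, hq, rfl⟩
    rw [map_mul] at hpq
    exact (mul_ne_zero hp0 hq0) hpq

/-- The Zariski topology on `GL n ℂ`. It is not an instance: `GL n ℂ` already carries the
Euclidean topology as one. -/
@[reducible]
def zariskiTopology (n : ℕ) : TopologicalSpace (GL (Fin n) ℂ) :=
  TopologicalSpace.ofClosed {S | IsZariskiClosed S} isZariskiClosed_empty
    (fun _ hA => IsZariskiClosed.sInter hA) (fun _ hS _ hT => IsZariskiClosed.union hS hT)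

/-- A Zariski closed subgroup of `GL n ℂ`, i.e. a linear algebraic group. -/
def IsAlgebraic {n : ℕ} (K : Subgroup (GL (Fin n) ℂ)) : Prop :=
  IsZariskiClosed (K : Set (GL (Fin n) ℂ))

/-- Connectedness in the Zariski topology. -/
def IsZariskiConnected {n : ℕ} (K : Subgroup (GL (Fin n) ℂ)) : Prop :=
  @IsConnected _ (zariskiTopology n) (K : Set (GL (Fin n) ℂ))

/-- The identity component `K⁰`: the connected component of `1` in `K`, for the Zariski
topology. -/
def identityComponent {n : ℕ} (K : Subgroup (GL (Fin n) ℂ)) : Set (GL (Fin n) ℂ) :=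
  @connectedComponentIn _ (zariskiTopology n) (K : Set (GL (Fin n) ℂ)) 1

/-- The centralizer `Z_G(h)` of `h` in `G`. -/
def centralizerIn {n : ℕ} (G : Subgroup (GL (Fin n) ℂ)) (h : GL (Fin n) ℂ) :
    Subgroup (GL (Fin n) ℂ) :=
  G ⊓ Subgroup.centralizer {h}

/-- All elements are unipotent matrices. -/
def IsUnipotent {n : ℕ} (K : Subgroup (GL (Fin n) ℂ)) : Prop :=
  ∀ g ∈ K, IsNilpotent ((g : Matrix (Fin n) (Fin n) ℂ) - 1)

/-- `U` is the unipotent radical of `K`: the largest closed connected normal unipotent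
subgroup of `K`. -/
def IsUnipotentRadical {n : ℕ} (U K : Subgroup (GL (Fin n) ℂ)) : Prop :=
  IsGreatest {N : Subgroup (GL (Fin n) ℂ) | N ≤ K ∧ (N.subgroupOf K).Normal ∧
    IsAlgebraic N ∧ IsZariskiConnected N ∧ IsUnipotent N} U

/-- A reductive group: a linear algebraic group with trivial unipotent radical. -/
def IsReductive {n : ℕ} (G : Subgroup (GL (Fin n) ℂ)) : Prop :=
  IsAlgebraic G ∧ IsUnipotentRadical ⊥ G

/-- A Borel subgroup of `G`: a maximal closed connected solvable subgroup. -/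
def IsBorel {n : ℕ} (B G : Subgroup (GL (Fin n) ℂ)) : Prop :=
  Maximal (fun K : Subgroup (GL (Fin n) ℂ) =>
    K ≤ G ∧ IsAlgebraic K ∧ IsZariskiConnected K ∧ Group.IsSolvable K) B

/-- A parabolic subgroup of `G`: a closed subgroup containing a Borel subgroup. -/
def IsParabolic {n : ℕ} (P G : Subgroup (GL (Fin n) ℂ)) : Prop :=
  P ≤ G ∧ IsAlgebraic P ∧ ∃ B, IsBorel B G ∧ B ≤ P

/-- A Levi subgroup of `P`: a closed subgroup `H` such that `P` is the semidirect product of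
`H` and the unipotent radical of `P`. (In characteristic zero the abstract semidirect product
decomposition is automatically one of algebraic groups.) -/
def IsLevi {n : ℕ} (H P : Subgroup (GL (Fin n) ℂ)) : Prop :=
  H ≤ P ∧ IsAlgebraic H ∧ ∃ U, IsUnipotentRadical U P ∧ H ⊓ U = ⊥ ∧ H ⊔ U = P

/-- A regular map (morphism of varieties) between closed subsets of general linear groups:
every matrix entry of `f x` is a polynomial in the entries of `x` and in `(det x)⁻¹`. -/
def IsRegularMap {m n : ℕ} {X : Set (GL (Fin m) ℂ)} {Y : Set (GL (Fin n) ℂ)}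
    (f : X → Y) : Prop :=
  ∀ i j : Fin n, ∃ p : MvPolynomial (Option (Fin m × Fin m)) ℂ, ∀ x : X,
    ((f x : GL (Fin n) ℂ) : Matrix (Fin n) (Fin n) ℂ) i j =
      MvPolynomial.eval (fun o : Option (Fin m × Fin m) =>
        o.elim (((x : GL (Fin m) ℂ) : Matrix (Fin m) (Fin m) ℂ).det)⁻¹
          (fun k => ((x : GL (Fin m) ℂ) : Matrix (Fin m) (Fin m) ℂ) k.1 k.2)) p

/-- An isomorphism of varieties: a regular map with a regular inverse. -/
def IsVarietyIso {m n : ℕ} {X : Set (GL (Fin m) ℂ)} {Y : Set (GL (Fin n) ℂ)}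
    (f : X → Y) : Prop :=
  IsRegularMap f ∧ ∃ g : Y → X,
    IsRegularMap g ∧ Function.LeftInverse g f ∧ Function.RightInverse g f

end LinAlgGroup

/-!
Write `σ u = h⁻¹ u h`, so that the map in question is `u ↦ (σ u)⁻¹ u`. The hypothesis on the
centralizer enters only through the fact that `σ` has no fixed point `u ≠ 1` in `U`: if `σ u = u`,
the complex powers `u ^ t = ∑ k, (t choose k) (u - 1) ^ k` form a connected curve in `Z_G(h)` through
`1` and `u`, so `u ∈ Z_G(h)⁰ ∩ U ⊆ H ∩ U = 1` (`mem_identityComponent_centralizerIn`). The powers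
`u ^ t` stay in `U` since `U` is Zariski closed and contains the `u ^ m` for natural numbers `m`
(`exists_mem_unipotentPow`).

The rest holds for every closed unipotent group `U` normalized by `h` on which `σ` has no nontrivial
fixed point (`exists_isVarietyIso_of_fixedPoints_trivial`). Injectivity is immediate. For a
polynomial inverse, let `N` be the linear span of the `u - 1`, `u ∈ U`. It is closed under
multiplication and all its elements have trace zero, so it is nilpotent
(`IsUnipotent.exists_augmentation_pow_eq_bot`). Filter `U` by the subgroups `U_i` of elements
congruent to `1` modulo `N ^ i`. Because of the complex powers, the image `V_i` of `U_i` in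
`N ^ i / N ^ (i + 1)` is a complex vector space (`leadingTerms`), on which `U_i` multiplies by
addition and the map acts as the linear map `1 - σ`.

By descending induction on `i`, the equation `(σ u)⁻¹ u = v` with `v ∈ U_i` is solved by some
`u ∈ U_i` polynomial in `v` (`exists_isPolyMap_solution`). Given this for `i + 1`, the linear map
`1 - σ` is injective on `V_i` (`mem_of_sub_invConj_mem`), hence bijective. So some product `a` of
complex powers of fixed elements of `U_i`, with exponents linear in `v - 1`, solves the equation
modulo `N ^ (i + 1)`; then `u = w a`, where `w ∈ U_(i + 1)` solves `(σ w)⁻¹ w = σ(a) v a⁻¹`.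
-/

namespace LinAlgGroup

open Matrix Polynomial

/-! ### Nilpotent subalgebras of matrix algebras -/

theorem trace_eq_zero_of_isNilpotent {n : ℕ} {x : Matrix (Fin n) (Fin n) ℂ}
    (hx : IsNilpotent x) : x.trace = 0 :=
  (Matrix.isNilpotent_trace_of_isNilpotent hx).eq_zero

theorem eq_zero_of_isIdempotentElem_of_trace_eq_zero {n : ℕ} {e : Matrix (Fin n) (Fin n) ℂ}
    (he : IsIdempotentElem e) (htr : e.trace = 0) : e = 0 := by
  have h1 : IsIdempotentElem (Matrix.toLin' e) := by
    rw [IsIdempotentElem, Module.End.mul_eq_comp, ← Matrix.toLin'_mul, he.eq]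
  have h2 : Matrix.toLin' e = 0 :=
    LinearMap.IsIdempotentElem.eq_zero_of_trace_eq_zero h1 (by rw [Matrix.trace_toLin'_eq, htr])
  exact (LinearEquiv.map_eq_zero_iff Matrix.toLin').1 h2

/-- If `a` were not nilpotent, some polynomial in `a` without constant term would be a nonzero
idempotent; it would lie in `N`, but its trace would be its rank. -/
theorem isNilpotent_of_trace_eq_zero {n : ℕ} {N : Submodule ℂ (Matrix (Fin n) (Fin n) ℂ)}
    (hmul : N * N ≤ N) (htr : ∀ x ∈ N, x.trace = 0) {a : Matrix (Fin n) (Fin n) ℂ}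
    (ha : a ∈ N) : IsNilpotent a := by
  have hpow : ∀ k : ℕ, a ^ (k + 1) ∈ N := by
    intro k
    induction k with
    | zero => simpa using ha
    | succ k ih => rw [pow_succ]; exact hmul (Submodule.mul_mem_mul ih ha)
  have hX : ∀ p : ℂ[X], aeval a (X * p) ∈ N := by
    intro p
    induction p using Polynomial.induction_on' with
    | add p q hp hq => rw [mul_add, map_add]; exact N.add_mem hp hq
    | monomial k c =>
      rw [X_mul_monomial, aeval_monomial, ← Algebra.smul_def]
      exact N.smul_mem _ (hpow k)
  obtain ⟨q, hq, hq0⟩ := exists_eq_pow_rootMultiplicity_mul_and_not_dvd a.charpoly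
    (Matrix.charpoly_monic a).ne_zero 0
  set r := a.charpoly.rootMultiplicity 0
  rw [C_0, sub_zero] at hq hq0
  obtain ⟨α, β, hαβ⟩ : IsCoprime (X ^ (r + 1)) q :=
    ((Polynomial.irreducible_X.coprime_iff_not_dvd).2 hq0).pow_left
  have hz : aeval a (X ^ (r + 1) * q) = 0 := by
    rw [pow_succ', mul_assoc, ← hq, map_mul, Matrix.aeval_self_charpoly, mul_zero]
  have hidem : IsIdempotentElem (aeval a (α * X ^ (r + 1))) := by
    have : α * X ^ (r + 1) * (α * X ^ (r + 1)) =
        α * X ^ (r + 1) - α * β * (X ^ (r + 1) * q) := by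
      linear_combination (α * X ^ (r + 1)) * hαβ
    rw [IsIdempotentElem, ← map_mul, this, map_sub, map_mul _ (α * β), hz, mul_zero, sub_zero]
  have he : aeval a (α * X ^ (r + 1)) = 0 := by
    have htr0 := htr _ (hX (α * X ^ r))
    rw [show X * (α * X ^ r) = α * X ^ (r + 1) by ring] at htr0
    exact eq_zero_of_isIdempotentElem_of_trace_eq_zero hidem htr0
  have hsplit : (X : ℂ[X]) ^ (r + 1) =
      X ^ (r + 1) * (α * X ^ (r + 1)) + β * (X ^ (r + 1) * q) := by
    linear_combination (-(X : ℂ[X]) ^ (r + 1)) * hαβ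
  have h := congrArg (aeval a) hsplit
  rw [map_add, map_mul _ (X ^ (r + 1)), map_mul _ β, he, hz, mul_zero, mul_zero, add_zero, map_pow,
    aeval_X] at h
  exact ⟨r + 1, h⟩

/-- A multiplicatively closed subspace of nilpotent elements of a finite-dimensional algebra is
nilpotent. The powers of `N` stabilize at some `M = M * M`. If `M ≠ 0`, a minimal
`M`-stable subspace `L` with `M * L ≠ 0` has the form `M * x` with `x ∈ L`, so `x = y * x` for a
nilpotent `y ∈ M`, and `x = 0`. -/
theorem exists_pow_eq_bot {A : Type*} [Ring A] [Algebra ℂ A] [FiniteDimensional ℂ A]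
    {N : Submodule ℂ A} (hmul : N * N ≤ N) (hnil : ∀ x ∈ N, IsNilpotent x) :
    ∃ K : ℕ, N ^ K = ⊥ := by
  have hanti : Antitone fun k : ℕ => N ^ (k + 1) := antitone_nat_of_succ_le fun k => by
    calc N ^ (k + 1 + 1) = N ^ k * (N * N) := by rw [pow_succ, pow_succ, mul_assoc]
      _ ≤ N ^ k * N := mul_le_mul' le_rfl hmul
      _ = N ^ (k + 1) := (pow_succ _ _).symm
  obtain ⟨m, hm⟩ := IsArtinian.monotone_stabilizes (R := ℂ) (M := A)
    ⟨fun k => OrderDual.toDual (N ^ (k + 1)), fun a b h => hanti h⟩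
  set M := N ^ (m + 1) with hM
  have hMM : M * M = M := by
    have := hm (m + m + 1) (by omega)
    have h2 : N ^ (m + 1) = N ^ (m + m + 1 + 1) := this
    rw [hM, ← pow_add, show m + 1 + (m + 1) = m + m + 1 + 1 by omega, ← h2]
  have hMN : M ≤ N := by simpa using hanti (Nat.zero_le m)
  refine ⟨m + 1, ?_⟩
  by_contra hne
  obtain ⟨L, ⟨hL, hL0⟩, hmin⟩ := WellFounded.has_min
    (wellFounded_lt (α := Submodule ℂ A)) {L | M * L ≤ L ∧ M * L ≠ ⊥}
    ⟨M, hMM.le, by rw [hMM]; exact hne⟩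
  obtain ⟨x, hxL, hx⟩ : ∃ x ∈ L, M * Submodule.span ℂ {x} ≠ ⊥ := by
    by_contra! hc
    refine hL0 (le_bot_iff.1 (Submodule.mul_le.2 fun y hy x hx => ?_))
    rw [← hc x hx]
    exact Submodule.mul_mem_mul hy (Submodule.mem_span_singleton_self x)
  have hle : M * Submodule.span ℂ {x} ≤ L :=
    (mul_le_mul' le_rfl ((Submodule.span_singleton_le_iff_mem _ _).2 hxL)).trans hL
  have heq : M * Submodule.span ℂ {x} = L := by
    by_contra hc
    refine hmin _ ⟨?_, ?_⟩ (lt_of_le_of_ne hle hc)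
    · rw [← mul_assoc, hMM]
    · rwa [← mul_assoc, hMM]
  obtain ⟨y, hy, hyx⟩ := Submodule.mem_mul_span_singleton.1 (heq ▸ hxL)
  obtain ⟨k, hk⟩ := hnil y (hMN hy)
  have hpow : ∀ k : ℕ, y ^ k * x = x := by
    intro k
    induction k with
    | zero => simp
    | succ k ih => rw [pow_succ, mul_assoc, hyx, ih]
  have hx0 : x = 0 := by rw [← hpow k, hk, zero_mul]
  exact hx (by simp [hx0])

/-! ### Complex powers of unipotent matrices -/

/-- The complex power `(1 + x) ^ t = ∑ k, (t choose k) x ^ k`, with the binomial series cut off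
after `k = K + 1`. For `x ^ K = 0` nothing is lost; the two extra terms make the constant and the
linear term split off for every `K`. -/
noncomputable def unipotentPow {n : ℕ} (K : ℕ) (x : Matrix (Fin n) (Fin n) ℂ) (t : ℂ) :
    Matrix (Fin n) (Fin n) ℂ :=
  ∑ k ∈ Finset.range (K + 2), ((descPochhammer ℂ k).eval t / (k.factorial : ℂ)) • x ^ k

theorem unipotentPow_natCast {n : ℕ} {K : ℕ} {x : Matrix (Fin n) (Fin n) ℂ} (hx : x ^ K = 0)
    (m : ℕ) : unipotentPow K x m = (1 + x) ^ m := by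
  have hc : ∀ k : ℕ, (descPochhammer ℂ k).eval (m : ℂ) / (k.factorial : ℂ) = (m.choose k : ℂ) := by
    intro k
    rw [descPochhammer_eval_eq_descFactorial, Nat.descFactorial_eq_factorial_mul_choose,
      Nat.cast_mul, mul_div_cancel_left₀ _ (Nat.cast_ne_zero.2 k.factorial_ne_zero)]
  rw [unipotentPow, add_comm 1 x, (Commute.one_right x).add_pow]
  simp only [hc, one_pow, mul_one]
  have h1 : ∑ k ∈ Finset.range (K + 2), (m.choose k : ℂ) • x ^ k =
      ∑ k ∈ Finset.range (K + 2 + (m + 1)), (m.choose k : ℂ) • x ^ k := by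
    refine Finset.sum_subset (by simp) fun k _ hk => ?_
    rw [pow_eq_zero_of_le (by simp at hk; omega) hx, smul_zero]
  have h2 : ∑ k ∈ Finset.range (m + 1), (m.choose k : ℂ) • x ^ k =
      ∑ k ∈ Finset.range (K + 2 + (m + 1)), (m.choose k : ℂ) • x ^ k := by
    refine Finset.sum_subset (by simp) fun k _ hk => ?_
    rw [Nat.choose_eq_zero_of_lt (by simp at hk; omega), Nat.cast_zero, zero_smul]
  rw [h1, ← h2]
  refine Finset.sum_congr rfl fun k _ => ?_
  rw [Nat.cast_smul_eq_nsmul, nsmul_eq_mul, Nat.cast_comm]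

theorem unipotentPow_eq {n : ℕ} (K : ℕ) (x : Matrix (Fin n) (Fin n) ℂ) (t : ℂ) :
    unipotentPow K x t = 1 + t • x + ∑ k ∈ Finset.range K,
      ((descPochhammer ℂ (k + 2)).eval t / ((k + 2).factorial : ℂ)) • x ^ (k + 2) := by
  rw [unipotentPow, Finset.sum_range_succ', Finset.sum_range_succ']
  simp [add_assoc, add_comm, add_left_comm]

theorem commute_unipotentPow {n : ℕ} (K : ℕ) {x y : Matrix (Fin n) (Fin n) ℂ} (t : ℂ)
    (h : Commute y x) : Commute y (unipotentPow K x t) :=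
  Commute.sum_right _ _ _ fun k _ => (h.pow_right k).smul_right _

theorem isUnit_unipotentPow {n : ℕ} {K : ℕ} {x : Matrix (Fin n) (Fin n) ℂ}
    (hx : IsNilpotent x) (t : ℂ) : IsUnit (unipotentPow K x t) := by
  rw [unipotentPow, Finset.sum_range_succ']
  have : ∑ k ∈ Finset.range (K + 1),
      ((descPochhammer ℂ (k + 1)).eval t / ((k + 1).factorial : ℂ)) • x ^ (k + 1) =
      x * ∑ k ∈ Finset.range (K + 1),
      ((descPochhammer ℂ (k + 1)).eval t / ((k + 1).factorial : ℂ)) • x ^ k := by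
    rw [Finset.mul_sum]
    exact Finset.sum_congr rfl fun k _ => by rw [pow_succ', mul_smul_comm]
  rw [this]
  have hn := Commute.isNilpotent_mul_right (y := ∑ k ∈ Finset.range (K + 1),
      ((descPochhammer ℂ (k + 1)).eval t / ((k + 1).factorial : ℂ)) • x ^ k)
      (Commute.sum_right _ _ _ fun k _ => ((Commute.refl x).pow_right k).smul_right _) hx
  simpa using hn.isUnit_add_one

/-- A polynomial in the entries of `unipotentPow K x t` is a polynomial in `t`. -/
theorem exists_polynomial_eval_unipotentPow {n : ℕ} (K : ℕ) (x : Matrix (Fin n) (Fin n) ℂ)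
    (p : MvPolynomial (Fin n × Fin n) ℂ) : ∃ q : ℂ[X], ∀ t : ℂ,
      q.eval t = MvPolynomial.eval (fun k => unipotentPow K x t k.1 k.2) p := by
  refine ⟨MvPolynomial.aeval (fun ij : Fin n × Fin n => ∑ k ∈ Finset.range (K + 2),
    descPochhammer ℂ k * C ((k.factorial : ℂ)⁻¹ * (x ^ k) ij.1 ij.2)) p, fun t => ?_⟩
  rw [← coe_evalRingHom, MvPolynomial.aeval_def, MvPolynomial.hom_eval₂, MvPolynomial.eval,
    MvPolynomial.coe_eval₂Hom]
  congr 1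
  · ext; simp
  · ext ij
    simp [unipotentPow, Matrix.sum_apply, div_eq_mul_inv, mul_assoc]

/-- A closed group contains the complex powers of its unipotent elements: a polynomial in `t` that
vanishes at the natural numbers is zero. -/
theorem exists_mem_unipotentPow {n : ℕ} {U : Subgroup (GL (Fin n) ℂ)} (hU : IsAlgebraic U)
    {u : GL (Fin n) ℂ} (hu : u ∈ U) {K : ℕ}
    (hK : ((u : Matrix (Fin n) (Fin n) ℂ) - 1) ^ K = 0) (t : ℂ) :
    ∃ g ∈ U, (g : Matrix (Fin n) (Fin n) ℂ) = unipotentPow K ((u : Matrix (Fin n) (Fin n) ℂ) - 1) t := by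
  obtain ⟨g, hg⟩ := isUnit_unipotentPow (K := K) ⟨K, hK⟩ t
  refine ⟨g, ?_, hg⟩
  obtain ⟨I, hI⟩ := hU
  rw [← SetLike.mem_coe, hI]
  intro p hp
  obtain ⟨q, hq⟩ := exists_polynomial_eval_unipotentPow K ((u : Matrix (Fin n) (Fin n) ℂ) - 1) p
  have hroot : ∀ m : ℕ, q.eval (m : ℂ) = 0 := by
    intro m
    have hm : u ^ m ∈ (U : Set (GL (Fin n) ℂ)) := U.pow_mem hu m
    rw [hI] at hm
    rw [hq, unipotentPow_natCast hK, ← hm p hp]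
    simp
  have hq0 : q = 0 := eq_zero_of_infinite_isRoot q
    ((Set.infinite_range_of_injective (Nat.cast_injective (R := ℂ))).mono
      (by rintro _ ⟨m, rfl⟩; exact hroot m))
  rw [hg, ← hq, hq0, eval_zero]

/-! ### Polynomial maps on the space of matrices -/

/-- A complex-valued function on matrices that is a polynomial in the entries. -/
def IsPolyFun {n : ℕ} (f : Matrix (Fin n) (Fin n) ℂ → ℂ) : Prop :=
  ∃ p : MvPolynomial (Fin n × Fin n) ℂ, ∀ x, f x = MvPolynomial.eval (fun k => x k.1 k.2) p

/-- A self-map of the space of matrices whose entries are polynomials. -/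
def IsPolyMap {n : ℕ} (f : Matrix (Fin n) (Fin n) ℂ → Matrix (Fin n) (Fin n) ℂ) : Prop :=
  ∀ i j, IsPolyFun fun x => f x i j

section Poly

variable {n : ℕ} {f g : Matrix (Fin n) (Fin n) ℂ → ℂ}
  {F F' : Matrix (Fin n) (Fin n) ℂ → Matrix (Fin n) (Fin n) ℂ}

theorem isPolyFun_const (c : ℂ) : IsPolyFun fun _ : Matrix (Fin n) (Fin n) ℂ => c :=
  ⟨MvPolynomial.C c, by simp⟩

theorem isPolyFun_entry (i j : Fin n) :
    IsPolyFun fun x : Matrix (Fin n) (Fin n) ℂ => x i j :=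
  ⟨MvPolynomial.X (i, j), by simp⟩

theorem IsPolyFun.add (hf : IsPolyFun f) (hg : IsPolyFun g) : IsPolyFun fun x => f x + g x := by
  obtain ⟨p, hp⟩ := hf
  obtain ⟨q, hq⟩ := hg
  exact ⟨p + q, fun x => by simp only [hp, hq, map_add]⟩

theorem IsPolyFun.mul (hf : IsPolyFun f) (hg : IsPolyFun g) : IsPolyFun fun x => f x * g x := by
  obtain ⟨p, hp⟩ := hf
  obtain ⟨q, hq⟩ := hg
  exact ⟨p * q, fun x => by simp only [hp, hq, map_mul]⟩

theorem IsPolyFun.sum {ι : Type*} (s : Finset ι) {f : ι → Matrix (Fin n) (Fin n) ℂ → ℂ}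
    (hf : ∀ i ∈ s, IsPolyFun (f i)) : IsPolyFun fun x => ∑ i ∈ s, f i x := by
  choose! p hp using hf
  exact ⟨∑ i ∈ s, p i, fun x => by
    rw [map_sum]; exact Finset.sum_congr rfl fun i hi => hp i hi x⟩

theorem IsPolyFun.polynomial_eval (hf : IsPolyFun f) (q : ℂ[X]) :
    IsPolyFun fun x => q.eval (f x) := by
  obtain ⟨p, hp⟩ := hf
  refine ⟨aeval p q, fun x => ?_⟩
  beta_reduce
  rw [hp, Polynomial.aeval_def, Polynomial.hom_eval₂, Polynomial.eval]
  congr 1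
  ext; simp

theorem IsPolyFun.comp (hf : IsPolyFun f) (hF : IsPolyMap F) : IsPolyFun fun x => f (F x) := by
  obtain ⟨p, hp⟩ := hf
  choose q hq using hF
  refine ⟨MvPolynomial.bind₁ (fun k => q k.1 k.2) p, fun x => ?_⟩
  beta_reduce
  rw [hp, ← MvPolynomial.coe_aeval_eq_eval, ← MvPolynomial.coe_aeval_eq_eval]
  simp only [RingHom.coe_coe]
  rw [MvPolynomial.aeval_bind₁]
  congr 2
  funext k
  exact hq _ _ x

theorem _root_.LinearMap.isPolyFun (φ : Matrix (Fin n) (Fin n) ℂ →ₗ[ℂ] ℂ) :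
    IsPolyFun fun x => φ x := by
  have : (fun x => φ x) = fun x : Matrix (Fin n) (Fin n) ℂ =>
      ∑ i, ∑ j, φ (Matrix.single i j 1) * x i j := by
    funext x
    conv_lhs => rw [Matrix.matrix_eq_sum_single x]
    simp only [map_sum]
    refine Finset.sum_congr rfl fun i _ => Finset.sum_congr rfl fun j _ => ?_
    rw [← mul_one (x i j), ← smul_eq_mul (x i j) 1, ← Matrix.smul_single, map_smul, smul_eq_mul,
      smul_eq_mul, mul_one, mul_comm]
  rw [this]
  exact .sum _ fun i _ => .sum _ fun j _ => (isPolyFun_const _).mul (isPolyFun_entry i j)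

theorem isPolyMap_id : IsPolyMap fun x : Matrix (Fin n) (Fin n) ℂ => x :=
  isPolyFun_entry

theorem isPolyMap_const (c : Matrix (Fin n) (Fin n) ℂ) : IsPolyMap fun _ => c :=
  fun i j => isPolyFun_const (c i j)

theorem IsPolyMap.add (hF : IsPolyMap F) (hF' : IsPolyMap F') : IsPolyMap fun x => F x + F' x :=
  fun i j => (hF i j).add (hF' i j)

theorem IsPolyMap.smul (hf : IsPolyFun f) (hF : IsPolyMap F) : IsPolyMap fun x => f x • F x :=
  fun i j => hf.mul (hF i j)

theorem IsPolyMap.sub (hF : IsPolyMap F) (hF' : IsPolyMap F') :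
    IsPolyMap fun x => F x - F' x := by
  simpa [sub_eq_add_neg] using hF.add (.smul (isPolyFun_const (-1)) hF')

theorem IsPolyMap.mul (hF : IsPolyMap F) (hF' : IsPolyMap F') :
    IsPolyMap fun x => F x * F' x := by
  intro i j
  simp only [Matrix.mul_apply]
  exact .sum _ fun k _ => (hF i k).mul (hF' k j)

theorem IsPolyMap.pow (hF : IsPolyMap F) (k : ℕ) : IsPolyMap fun x => F x ^ k := by
  induction k with
  | zero => simpa using isPolyMap_const 1
  | succ k ih => simpa only [pow_succ] using ih.mul hF

theorem IsPolyMap.sum {ι : Type*} (s : Finset ι)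
    {F : ι → Matrix (Fin n) (Fin n) ℂ → Matrix (Fin n) (Fin n) ℂ}
    (hF : ∀ i ∈ s, IsPolyMap (F i)) : IsPolyMap fun x => ∑ i ∈ s, F i x := by
  intro i j
  simp only [Matrix.sum_apply]
  exact .sum _ fun k hk => hF k hk i j

theorem IsPolyMap.comp (hF : IsPolyMap F) (hF' : IsPolyMap F') : IsPolyMap fun x => F (F' x) :=
  fun i j => (hF i j).comp hF'

theorem IsPolyFun.unipotentPow (hf : IsPolyFun f) (K : ℕ) (x : Matrix (Fin n) (Fin n) ℂ) :
    IsPolyMap fun y => unipotentPow K x (f y) :=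
  .sum _ fun k _ => .smul (by
    simp only [div_eq_mul_inv]
    exact (hf.polynomial_eval _).mul (isPolyFun_const _)) (isPolyMap_const _)

/-- On unipotent matrices, inversion is given by a geometric sum. -/
theorem exists_isPolyMap_inv (K : ℕ) : ∃ J : Matrix (Fin n) (Fin n) ℂ → Matrix (Fin n) (Fin n) ℂ,
    IsPolyMap J ∧ ∀ u : GL (Fin n) ℂ, ((u : Matrix (Fin n) (Fin n) ℂ) - 1) ^ K = 0 →
      J u = ((u⁻¹ : GL (Fin n) ℂ) : Matrix (Fin n) (Fin n) ℂ) := by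
  refine ⟨fun x => ∑ k ∈ Finset.range K, (1 - x) ^ k,
    .sum _ fun k _ => ((isPolyMap_const 1).sub isPolyMap_id).pow k, fun u hu => ?_⟩
  have h1 : (1 - (u : Matrix (Fin n) (Fin n) ℂ)) ^ K = 0 := by
    rw [← neg_sub, neg_pow, hu, mul_zero]
  have h2 := mul_neg_geom_sum (1 - (u : Matrix (Fin n) (Fin n) ℂ)) K
  rw [h1, sub_zero, sub_sub_cancel] at h2
  beta_reduce
  rw [← Units.inv_mul_cancel_left u (∑ k ∈ Finset.range K, _), h2, mul_one]

/-- A map of closed subsets of `GL n ℂ` that extends to a polynomial self-map of the space of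
matrices is regular. -/
theorem IsPolyMap.isRegularMap (hF : IsPolyMap F) {X Y : Set (GL (Fin n) ℂ)} {φ : X → Y}
    (h : ∀ x : X, ((φ x : GL (Fin n) ℂ) : Matrix (Fin n) (Fin n) ℂ) =
      F ((x : GL (Fin n) ℂ) : Matrix (Fin n) (Fin n) ℂ)) : IsRegularMap φ := by
  intro i j
  obtain ⟨p, hp⟩ := hF i j
  refine ⟨MvPolynomial.rename some p, fun x => ?_⟩
  rw [h, MvPolynomial.eval_rename]
  exact hp _

end Poly

/-! ### Inverting a linear map on a subquotient -/

/-- If `T` preserves subspaces `F ≤ W` and is injective on `W / F`, then it is invertible there,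
and the inverse can be written with representatives taken from any set that covers `W` modulo
`F`. -/
theorem exists_linear_lift {E : Type*} [AddCommGroup E] [Module ℂ E] [FiniteDimensional ℂ E]
    {F W : Submodule ℂ E} {T : E →ₗ[ℂ] E} (hTW : ∀ x ∈ W, T x ∈ W)
    (hTF : ∀ x ∈ F, T x ∈ F) (hinj : ∀ x ∈ W, T x ∈ F → x ∈ F) {S : Set E}
    (hS : ∀ w ∈ W, ∃ s ∈ S, w - s ∈ F) :
    ∃ (d : ℕ) (s : Fin d → E) (φ : Fin d → E →ₗ[ℂ] ℂ), (∀ j, s j ∈ S) ∧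
      ∀ y ∈ W, T (∑ j, φ j y • s j) - y ∈ F := by
  set V := W.map F.mkQ
  set T' : E ⧸ F →ₗ[ℂ] E ⧸ F := F.mapQ F T hTF
  have hT' : ∀ x, T' (F.mkQ x) = F.mkQ (T x) := fun x => rfl
  have hTV : ∀ v ∈ V, T' v ∈ V := by
    rintro _ ⟨x, hx, rfl⟩
    exact ⟨T x, hTW x hx, rfl⟩
  have hsurj : Function.Surjective (T'.restrict hTV) := by
    refine LinearMap.injective_iff_surjective.1 ((injective_iff_map_eq_zero _).2 ?_)
    rintro ⟨_, x, hx, rfl⟩ h0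
    have h1 : F.mkQ (T x) = 0 := congrArg Subtype.val h0
    have h2 : F.mkQ x = 0 := by
      rw [Submodule.mkQ_apply, Submodule.Quotient.mk_eq_zero] at h1 ⊢
      exact hinj x hx h1
    exact Subtype.ext h2
  let b := Module.finBasis ℂ V
  have hw : ∀ j, ∃ s ∈ S, F.mkQ (T s) = b j := by
    intro j
    obtain ⟨⟨_, x, hx, rfl⟩, h0⟩ := hsurj (b j)
    obtain ⟨s, hs, hxs⟩ := hS x hx
    refine ⟨s, hs, ?_⟩
    have h1 : F.mkQ x = F.mkQ s := by
      rw [← sub_eq_zero, ← map_sub, Submodule.mkQ_apply, Submodule.Quotient.mk_eq_zero]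
      exact hxs
    rw [← hT', ← h1, ← h0]
    rfl
  choose s hs hsb using hw
  choose φ hφ using fun j => (b.coord j).exists_extend
  refine ⟨_, s, fun j => φ j ∘ₗ F.mkQ, hs, fun y hy => ?_⟩
  rw [← Submodule.Quotient.mk_eq_zero, ← Submodule.mkQ_apply, map_sub, sub_eq_zero]
  simp only [map_sum, map_smul, hsb]
  have hyV : F.mkQ y ∈ V := ⟨y, hy, rfl⟩
  have h2 := congrArg Subtype.val (b.sum_repr ⟨F.mkQ y, hyV⟩)
  simp only [Submodule.coe_sum, Submodule.coe_smul] at h2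
  rw [← h2]
  refine Finset.sum_congr rfl fun j _ => ?_
  have h3 := LinearMap.congr_fun (hφ j) ⟨F.mkQ y, hyV⟩
  simp only [LinearMap.comp_apply, Submodule.subtype_apply, Module.Basis.coord_apply] at h3
  simp only [LinearMap.comp_apply, h3]

/-! ### The filtration by powers of the augmentation ideal -/

section

variable {A : Type*} [Ring A] [Algebra ℂ A] {N : Submodule ℂ A}

theorem pow_le_pow_of_mul_le (hmul : N * N ≤ N) {i j : ℕ} (hi : 1 ≤ i) (hij : i ≤ j) :
    N ^ j ≤ N ^ i := by
  induction j, hij using Nat.le_induction with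
  | base => exact le_rfl
  | succ k hk ih =>
    obtain ⟨k, rfl⟩ : ∃ l, k = l + 1 := ⟨k - 1, by omega⟩
    refine le_trans ?_ ih
    calc N ^ (k + 1 + 1) = N ^ k * (N * N) := by rw [pow_succ, pow_succ, mul_assoc]
      _ ≤ N ^ k * N := mul_le_mul' le_rfl hmul
      _ = N ^ (k + 1) := (pow_succ _ _).symm

theorem mul_mem_pow_of_mul_le (hmul : N * N ≤ N) {i j l : ℕ} (hl : 1 ≤ l) (hij : l ≤ i + j)
    {x y : A} (hx : x ∈ N ^ i) (hy : y ∈ N ^ j) : x * y ∈ N ^ l :=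
  pow_le_pow_of_mul_le hmul hl hij (by rw [pow_add]; exact Submodule.mul_mem_mul hx hy)

end

variable {n : ℕ}

/-- The linear span of all the `u - 1` with `u ∈ U`: the augmentation ideal of the matrix algebra
spanned by `U`. -/
def augmentation (U : Subgroup (GL (Fin n) ℂ)) : Submodule ℂ (Matrix (Fin n) (Fin n) ℂ) :=
  Submodule.span ℂ {x | ∃ u ∈ U, (u : Matrix (Fin n) (Fin n) ℂ) - 1 = x}

theorem sub_one_mem_augmentation {U : Subgroup (GL (Fin n) ℂ)} {u : GL (Fin n) ℂ} (hu : u ∈ U) :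
    (u : Matrix (Fin n) (Fin n) ℂ) - 1 ∈ augmentation U :=
  Submodule.subset_span ⟨u, hu, rfl⟩

theorem augmentation_mul_le (U : Subgroup (GL (Fin n) ℂ)) :
    augmentation U * augmentation U ≤ augmentation U := by
  rw [augmentation, Submodule.span_mul_span, Submodule.span_le]
  rintro _ ⟨_, ⟨u, hu, rfl⟩, _, ⟨v, hv, rfl⟩, rfl⟩
  have h : ((u : Matrix (Fin n) (Fin n) ℂ) - 1) * ((v : Matrix (Fin n) (Fin n) ℂ) - 1) =
      (((u * v : GL (Fin n) ℂ) : Matrix (Fin n) (Fin n) ℂ) - 1) -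
        ((u : Matrix (Fin n) (Fin n) ℂ) - 1) - ((v : Matrix (Fin n) (Fin n) ℂ) - 1) := by
    rw [Units.val_mul]; noncomm_ring
  simp only [SetLike.mem_coe]
  rw [h]
  exact Submodule.sub_mem _ (Submodule.sub_mem _ (sub_one_mem_augmentation (U.mul_mem hu hv))
    (sub_one_mem_augmentation hu)) (sub_one_mem_augmentation hv)

/-- Kolchin's theorem, in the form that the augmentation ideal of a unipotent group is
nilpotent. -/
theorem IsUnipotent.exists_augmentation_pow_eq_bot {U : Subgroup (GL (Fin n) ℂ)}
    (hU : IsUnipotent U) : ∃ K : ℕ, augmentation U ^ K = ⊥ := by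
  refine exists_pow_eq_bot (augmentation_mul_le U) fun x hx =>
    isNilpotent_of_trace_eq_zero (augmentation_mul_le U) (fun y hy => ?_) hx
  have hle : augmentation U ≤ LinearMap.ker (Matrix.traceLinearMap (Fin n) ℂ ℂ) := by
    rw [augmentation, Submodule.span_le]
    rintro _ ⟨u, hu, rfl⟩
    exact trace_eq_zero_of_isNilpotent (hU u hu)
  exact hle hy

/-- Conjugation `x ↦ h⁻¹ * x * h` on the algebra of matrices. -/
noncomputable def invConj (h : GL (Fin n) ℂ) :
    Matrix (Fin n) (Fin n) ℂ →ₐ[ℂ] Matrix (Fin n) (Fin n) ℂ :=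
  AlgHom.ofLinearMap
    (LinearMap.mulRight ℂ (h : Matrix (Fin n) (Fin n) ℂ) ∘ₗ
      LinearMap.mulLeft ℂ ((h⁻¹ : GL (Fin n) ℂ) : Matrix (Fin n) (Fin n) ℂ))
    (by simp) (fun x y => by
      simp only [LinearMap.comp_apply, LinearMap.mulLeft_apply, LinearMap.mulRight_apply]
      simp only [mul_assoc, Units.mul_inv_cancel_left])

theorem coe_conj (h u : GL (Fin n) ℂ) :
    ((h⁻¹ * u * h : GL (Fin n) ℂ) : Matrix (Fin n) (Fin n) ℂ) = invConj h u := rfl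

theorem invConj_mem_augmentation_pow {U : Subgroup (GL (Fin n) ℂ)} {h : GL (Fin n) ℂ}
    (hnorm : ∀ u ∈ U, h⁻¹ * u * h ∈ U) (i : ℕ) {x : Matrix (Fin n) (Fin n) ℂ}
    (hx : x ∈ augmentation U ^ i) : invConj h x ∈ augmentation U ^ i := by
  have h1 : (augmentation U).map (invConj h).toLinearMap ≤ augmentation U := by
    rw [augmentation, Submodule.map_span, Submodule.span_le]
    rintro _ ⟨_, ⟨u, hu, rfl⟩, rfl⟩
    refine Submodule.subset_span ⟨_, hnorm u hu, ?_⟩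
    rw [AlgHom.toLinearMap_apply, map_sub, map_one, coe_conj]
  have h2 : (augmentation U ^ i).map (invConj h).toLinearMap ≤ augmentation U ^ i := by
    rw [Submodule.map_pow]
    exact pow_le_pow_left' h1 i
  exact h2 ⟨x, hx, rfl⟩

/-- The elements of `U` congruent to `1` modulo the `i`-th power of the augmentation ideal, as a
set: only closure under multiplication is needed. -/
def congruenceSubgroup (U : Subgroup (GL (Fin n) ℂ)) (i : ℕ) : Set (GL (Fin n) ℂ) :=
  {u | u ∈ U ∧ (u : Matrix (Fin n) (Fin n) ℂ) - 1 ∈ augmentation U ^ i}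

variable {U : Subgroup (GL (Fin n) ℂ)} {i K : ℕ}

theorem mul_mem_congruenceSubgroup (hi : 1 ≤ i) {u v : GL (Fin n) ℂ}
    (hu : u ∈ congruenceSubgroup U i) (hv : v ∈ congruenceSubgroup U i) :
    u * v ∈ congruenceSubgroup U i := by
  refine ⟨U.mul_mem hu.1 hv.1, ?_⟩
  have h : ((u * v : GL (Fin n) ℂ) : Matrix (Fin n) (Fin n) ℂ) - 1 =
      ((u : Matrix (Fin n) (Fin n) ℂ) - 1) * ((v : Matrix (Fin n) (Fin n) ℂ) - 1) +
        ((u : Matrix (Fin n) (Fin n) ℂ) - 1) + ((v : Matrix (Fin n) (Fin n) ℂ) - 1) := by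
    rw [Units.val_mul]; noncomm_ring
  rw [h]
  exact Submodule.add_mem _ (Submodule.add_mem _
    (mul_mem_pow_of_mul_le (augmentation_mul_le U) hi (by omega) hu.2 hv.2) hu.2) hv.2

/-- The powers of the augmentation ideal are stable under right multiplication by `U`. -/
theorem mul_mem_augmentation_pow (hi : 1 ≤ i) {x : Matrix (Fin n) (Fin n) ℂ}
    (hx : x ∈ augmentation U ^ i) {u : GL (Fin n) ℂ} (hu : u ∈ U) :
    x * (u : Matrix (Fin n) (Fin n) ℂ) ∈ augmentation U ^ i := by
  have h : x * (u : Matrix (Fin n) (Fin n) ℂ) = x * ((u : Matrix (Fin n) (Fin n) ℂ) - 1) + x := by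
    noncomm_ring
  rw [h]
  exact Submodule.add_mem _ (mul_mem_pow_of_mul_le (j := 1) (augmentation_mul_le U) hi (by omega)
    hx (by rw [pow_one]; exact sub_one_mem_augmentation hu)) hx

theorem mul_mem_augmentation_pow' (hi : 1 ≤ i) {x : Matrix (Fin n) (Fin n) ℂ}
    (hx : x ∈ augmentation U ^ i) {u : GL (Fin n) ℂ} (hu : u ∈ U) :
    (u : Matrix (Fin n) (Fin n) ℂ) * x ∈ augmentation U ^ i := by
  have h : (u : Matrix (Fin n) (Fin n) ℂ) * x = ((u : Matrix (Fin n) (Fin n) ℂ) - 1) * x + x := by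
    noncomm_ring
  rw [h]
  exact Submodule.add_mem _ (mul_mem_pow_of_mul_le (i := 1) (augmentation_mul_le U) hi (by omega)
    (by rw [pow_one]; exact sub_one_mem_augmentation hu) hx) hx

theorem sub_one_pow_eq_zero (hK : augmentation U ^ K = ⊥) {u : GL (Fin n) ℂ} (hu : u ∈ U) :
    ((u : Matrix (Fin n) (Fin n) ℂ) - 1) ^ K = 0 := by
  have := Submodule.pow_mem_pow _ (sub_one_mem_augmentation hu) K
  rwa [hK, Submodule.mem_bot] at this

/-- To first order, `u ^ t` is `1 + t • (u - 1)`. -/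
theorem unipotentPow_sub_mem (hi : 1 ≤ i) {x : Matrix (Fin n) (Fin n) ℂ}
    (hx : x ∈ augmentation U ^ i) (t : ℂ) :
    unipotentPow K x t - 1 - t • x ∈ augmentation U ^ (i + 1) := by
  rw [unipotentPow_eq, add_assoc, add_sub_cancel_left, add_sub_cancel_left]
  refine Submodule.sum_mem _ fun k _ => Submodule.smul_mem _ _ ?_
  have h := Submodule.pow_mem_pow _ hx (k + 2)
  rw [← pow_mul] at h
  exact pow_le_pow_of_mul_le (augmentation_mul_le U) (by omega) (by nlinarith) h

theorem exists_mem_congruenceSubgroup_unipotentPow (hU : IsAlgebraic U)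
    (hK : augmentation U ^ K = ⊥) (hi : 1 ≤ i) {u : GL (Fin n) ℂ}
    (hu : u ∈ congruenceSubgroup U i) (t : ℂ) : ∃ g ∈ congruenceSubgroup U i,
      (g : Matrix (Fin n) (Fin n) ℂ) = unipotentPow K ((u : Matrix (Fin n) (Fin n) ℂ) - 1) t := by
  obtain ⟨g, hgU, hg⟩ := exists_mem_unipotentPow hU hu.1 (sub_one_pow_eq_zero hK hu.1) t
  refine ⟨g, ⟨hgU, ?_⟩, hg⟩
  rw [hg, ← sub_add_cancel (unipotentPow K _ t - 1) (t • ((u : Matrix (Fin n) (Fin n) ℂ) - 1))]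
  exact Submodule.add_mem _ (pow_le_pow_of_mul_le (augmentation_mul_le U) hi (Nat.le_succ i)
    (unipotentPow_sub_mem hi hu.2 t)) (Submodule.smul_mem _ _ hu.2)

/-- First-order parts `u - 1` of the elements of the `i`-th congruence subgroup, modulo the next
power of the augmentation ideal. They form a complex subspace because `U` contains the complex
powers of its elements. -/
def leadingTerms (hU : IsAlgebraic U) (hK : augmentation U ^ K = ⊥) (hi : 1 ≤ i) :
    Submodule ℂ (Matrix (Fin n) (Fin n) ℂ) where
  carrier := {x | ∃ u ∈ congruenceSubgroup U i,
    x - ((u : Matrix (Fin n) (Fin n) ℂ) - 1) ∈ augmentation U ^ (i + 1)}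
  zero_mem' := ⟨1, ⟨U.one_mem, by simp⟩, by simp⟩
  add_mem' := by
    rintro x y ⟨u, hu, hx⟩ ⟨v, hv, hy⟩
    refine ⟨u * v, mul_mem_congruenceSubgroup hi hu hv, ?_⟩
    have h : x + y - (((u * v : GL (Fin n) ℂ) : Matrix (Fin n) (Fin n) ℂ) - 1) =
        (x - ((u : Matrix (Fin n) (Fin n) ℂ) - 1)) + (y - ((v : Matrix (Fin n) (Fin n) ℂ) - 1)) -
        ((u : Matrix (Fin n) (Fin n) ℂ) - 1) * ((v : Matrix (Fin n) (Fin n) ℂ) - 1) := by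
      rw [Units.val_mul]; noncomm_ring
    rw [h]
    exact Submodule.sub_mem _ (Submodule.add_mem _ hx hy)
      (mul_mem_pow_of_mul_le (augmentation_mul_le U) (by omega) (by omega) hu.2 hv.2)
  smul_mem' := by
    rintro t x ⟨u, hu, hx⟩
    obtain ⟨g, hg, hgu⟩ := exists_mem_congruenceSubgroup_unipotentPow hU hK hi hu t
    refine ⟨g, hg, ?_⟩
    have h : t • x - ((g : Matrix (Fin n) (Fin n) ℂ) - 1) =
        t • (x - ((u : Matrix (Fin n) (Fin n) ℂ) - 1)) -
        ((g : Matrix (Fin n) (Fin n) ℂ) - 1 - t • ((u : Matrix (Fin n) (Fin n) ℂ) - 1)) := by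
      rw [smul_sub]; abel
    rw [h, hgu]
    exact Submodule.sub_mem _ (Submodule.smul_mem _ _ hx) (unipotentPow_sub_mem hi hu.2 t)

/-- Given elements `s j` of the `i`-th congruence subgroup and polynomial functions `φ j`, the
product of the powers `s j ^ φ j x` depends polynomially on `x` and has first-order part
`∑ j, φ j x • (s j - 1)`. -/
theorem exists_isPolyMap_prod_pow (hU : IsAlgebraic U) (hK : augmentation U ^ K = ⊥) (hi : 1 ≤ i)
    {ι : Type*} (J : Finset ι) (s : ι → GL (Fin n) ℂ) (hs : ∀ j, s j ∈ congruenceSubgroup U i)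
    (φ : ι → Matrix (Fin n) (Fin n) ℂ → ℂ) (hφ : ∀ j, IsPolyFun (φ j)) :
    ∃ F : Matrix (Fin n) (Fin n) ℂ → Matrix (Fin n) (Fin n) ℂ, IsPolyMap F ∧
      ∀ x, ∃ u ∈ congruenceSubgroup U i, (u : Matrix (Fin n) (Fin n) ℂ) = F x ∧
        F x - 1 - ∑ j ∈ J, φ j x • ((s j : Matrix (Fin n) (Fin n) ℂ) - 1) ∈
          augmentation U ^ (i + 1) := by
  classical
  induction J using Finset.induction_on with
  | empty => exact ⟨fun _ => 1, isPolyMap_const 1, fun x => ⟨1, ⟨U.one_mem, by simp⟩, by simp⟩⟩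
  | insert a J ha ih =>
    obtain ⟨F, hF, h⟩ := ih
    refine ⟨fun x => unipotentPow K ((s a : Matrix (Fin n) (Fin n) ℂ) - 1) (φ a x) * F x,
      ((hφ a).unipotentPow K _).mul hF, fun x => ?_⟩
    obtain ⟨u, hu, huF, hux⟩ := h x
    obtain ⟨g, hg, hga⟩ := exists_mem_congruenceSubgroup_unipotentPow hU hK hi (hs a) (φ a x)
    refine ⟨g * u, mul_mem_congruenceSubgroup hi hg hu, by rw [Units.val_mul, hga, huF], ?_⟩
    have h1 := unipotentPow_sub_mem (K := K) hi (hs a).2 (φ a x)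
    have h2 := mul_mem_pow_of_mul_le (augmentation_mul_le U) (l := i + 1) (by omega) (by omega)
      hg.2 hu.2
    rw [hga, huF] at h2
    rw [Finset.sum_insert ha]
    convert Submodule.add_mem _ (Submodule.add_mem _ h1 hux) h2 using 1
    noncomm_ring

/-! ### Solving the conjugation equation -/

variable {h : GL (Fin n) ℂ}

/-- The equation `(h⁻¹ * u * h)⁻¹ * u = v` determines `u`. -/
theorem eq_of_conj_inv_mul_eq (hfix : ∀ u ∈ U, h⁻¹ * u * h = u → u = 1) {u w : GL (Fin n) ℂ}
    (hu : u ∈ U) (hw : w ∈ U) (huw : (h⁻¹ * u * h)⁻¹ * u = (h⁻¹ * w * h)⁻¹ * w) : u = w := by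
  refine mul_inv_eq_one.1 (hfix (u * w⁻¹) (U.mul_mem hu (U.inv_mem hw)) ?_)
  have h1 : u = h⁻¹ * u * h * ((h⁻¹ * w * h)⁻¹ * w) := by rw [← huw]; group
  calc h⁻¹ * (u * w⁻¹) * h = h⁻¹ * u * h * ((h⁻¹ * w * h)⁻¹ * w) * w⁻¹ := by group
    _ = u * w⁻¹ := by rw [← h1]

theorem sub_invConj_mem_leadingTerms (hU : IsAlgebraic U) (hK : augmentation U ^ K = ⊥)
    (hnorm : ∀ u ∈ U, h⁻¹ * u * h ∈ U) (hi : 1 ≤ i) {x : Matrix (Fin n) (Fin n) ℂ}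
    (hx : x ∈ leadingTerms hU hK hi) : x - invConj h x ∈ leadingTerms hU hK hi := by
  refine Submodule.sub_mem _ hx ?_
  obtain ⟨u, hu, hxu⟩ := hx
  have h1 : ∀ y : Matrix (Fin n) (Fin n) ℂ, invConj h (y - 1) = invConj h y - 1 := fun y => by
    rw [map_sub, map_one]
  refine ⟨h⁻¹ * u * h, ⟨hnorm u hu.1, ?_⟩, ?_⟩
  · rw [coe_conj, ← h1]
    exact invConj_mem_augmentation_pow hnorm i hu.2
  · rw [coe_conj, ← h1, ← map_sub]
    exact invConj_mem_augmentation_pow hnorm (i + 1) hxu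

/-- If `u ↦ (h⁻¹ * u * h)⁻¹ * u` is onto the next congruence subgroup, then `1 - Ad h⁻¹` is
injective on the first-order parts: an element moved into the next congruence subgroup has the
same image as some element of that subgroup, hence lies in it. -/
theorem mem_of_sub_invConj_mem (hU : IsAlgebraic U) (hK : augmentation U ^ K = ⊥)
    (hnorm : ∀ u ∈ U, h⁻¹ * u * h ∈ U) (hfix : ∀ u ∈ U, h⁻¹ * u * h = u → u = 1) (hi : 1 ≤ i)
    (hsurj : ∀ v ∈ congruenceSubgroup U (i + 1),
      ∃ u ∈ congruenceSubgroup U (i + 1), (h⁻¹ * u * h)⁻¹ * u = v)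
    {x : Matrix (Fin n) (Fin n) ℂ} (hx : x ∈ leadingTerms hU hK hi)
    (hTx : x - invConj h x ∈ augmentation U ^ (i + 1)) : x ∈ augmentation U ^ (i + 1) := by
  obtain ⟨u, hu, hxu⟩ := hx
  have h1 : (u : Matrix (Fin n) (Fin n) ℂ) - invConj h u ∈ augmentation U ^ (i + 1) := by
    have h2 := invConj_mem_augmentation_pow hnorm (i + 1) hxu
    have h3 := Submodule.add_mem _ (Submodule.sub_mem _ hTx hxu) h2
    rw [map_sub, map_sub, map_one] at h3
    convert h3 using 1
    abel
  have hσ := hnorm u hu.1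
  have h4 := mul_mem_augmentation_pow' (by omega) h1 (U.inv_mem hσ)
  rw [mul_sub, ← coe_conj, ← Units.val_mul, ← Units.val_mul, inv_mul_cancel, Units.val_one] at h4
  obtain ⟨w, hw, hwu⟩ := hsurj _ ⟨U.mul_mem (U.inv_mem hσ) hu.1, h4⟩
  rw [eq_of_conj_inv_mul_eq hfix hw.1 hu.1 hwu] at hw
  have h5 := Submodule.add_mem _ hxu hw.2
  rwa [sub_add_cancel] at h5

/-- On each congruence subgroup the equation `(h⁻¹ * u * h)⁻¹ * u = v` has a solution `u` that
depends polynomially on `v`. The induction descends along the powers of the augmentation ideal. -/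
theorem exists_isPolyMap_solution (hU : IsAlgebraic U) (hK : augmentation U ^ K = ⊥)
    (hnorm : ∀ u ∈ U, h⁻¹ * u * h ∈ U) (hfix : ∀ u ∈ U, h⁻¹ * u * h = u → u = 1)
    (m : ℕ) : ∀ i : ℕ, 1 ≤ i → K ≤ i + m →
      ∃ g : Matrix (Fin n) (Fin n) ℂ → Matrix (Fin n) (Fin n) ℂ, IsPolyMap g ∧
        ∀ v ∈ congruenceSubgroup U i, ∃ u ∈ congruenceSubgroup U i,
          (u : Matrix (Fin n) (Fin n) ℂ) = g v ∧ (h⁻¹ * u * h)⁻¹ * u = v := by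
  induction m with
  | zero =>
    intro i hi hKi
    refine ⟨fun _ => 1, isPolyMap_const 1, fun v hv => ?_⟩
    have h1 : augmentation U ^ i = ⊥ := pow_eq_zero_of_le (by simpa using hKi) hK
    have h2 : v = 1 := by
      have := hv.2
      rw [h1, Submodule.mem_bot, sub_eq_zero] at this
      exact Units.ext this
    exact ⟨1, ⟨U.one_mem, by simp⟩, by simp, by simp [h2]⟩
  | succ m ih =>
    intro i hi hKi
    obtain ⟨g, hg, hgs⟩ := ih (i + 1) (by omega) (by omega)
    obtain ⟨J, hJ, hJinv⟩ := exists_isPolyMap_inv (n := n) K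
    set T : Matrix (Fin n) (Fin n) ℂ →ₗ[ℂ] Matrix (Fin n) (Fin n) ℂ :=
      LinearMap.id - (invConj h).toLinearMap
    have hTapp : ∀ x, T x = x - invConj h x := fun x => rfl
    obtain ⟨d, s, φ, hs, hφ⟩ := exists_linear_lift (F := augmentation U ^ (i + 1))
      (W := leadingTerms hU hK hi) (T := T)
      (S := {x | ∃ u ∈ congruenceSubgroup U i, (u : Matrix (Fin n) (Fin n) ℂ) - 1 = x})
      (fun x hx => sub_invConj_mem_leadingTerms hU hK hnorm hi hx)
      (fun x hx => Submodule.sub_mem _ hx (invConj_mem_augmentation_pow hnorm _ hx))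
      (fun x hx hTx => mem_of_sub_invConj_mem hU hK hnorm hfix hi
        (fun v hv => (hgs v hv).imp fun u hu => ⟨hu.1, hu.2.2⟩) hx hTx)
      (fun w ⟨u, hu, hw⟩ => ⟨_, ⟨u, hu, rfl⟩, hw⟩)
    choose s' hs' hss' using hs
    obtain ⟨F, hF, hFs⟩ := exists_isPolyMap_prod_pow hU hK hi Finset.univ s' hs'
      (fun j x => φ j (x - 1))
      (fun j => (φ j).isPolyFun.comp (isPolyMap_id.sub (isPolyMap_const 1)))
    refine ⟨fun x => g (((h⁻¹ : GL (Fin n) ℂ) : Matrix (Fin n) (Fin n) ℂ) * F x * h * x * J (F x)) *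
      F x, (hg.comp ((((((isPolyMap_const _).mul hF).mul (isPolyMap_const _)).mul
        isPolyMap_id).mul (hJ.comp hF)))).mul hF, fun v hv => ?_⟩
    obtain ⟨a, ha, haF, hsum⟩ := hFs v
    have hinv := hJinv a (sub_one_pow_eq_zero hK ha.1)
    have hσ := hnorm a ha.1
    -- `a` solves the equation to first order; the error is corrected in the next subgroup.
    have herr : h⁻¹ * a * h * v * a⁻¹ ∈ congruenceSubgroup U (i + 1) := by
      refine ⟨U.mul_mem (U.mul_mem hσ hv.1) (U.inv_mem ha.1), ?_⟩
      have h1 : T ((a : Matrix (Fin n) (Fin n) ℂ) - 1) - ((v : Matrix (Fin n) (Fin n) ℂ) - 1) ∈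
          augmentation U ^ (i + 1) := by
        have h2 := hφ (v - 1) ⟨v, hv, by simp⟩
        simp only [← hss'] at h2
        rw [← haF] at hsum
        have h3 := Submodule.sub_mem _ hsum (invConj_mem_augmentation_pow hnorm _ hsum)
        rw [← hTapp, map_sub] at h3
        convert Submodule.add_mem _ h3 h2 using 1
        abel
      have h4 : invConj h ((a : Matrix (Fin n) (Fin n) ℂ) - 1) * ((v : Matrix (Fin n) (Fin n) ℂ) - 1)
          ∈ augmentation U ^ (i + 1) :=
        mul_mem_pow_of_mul_le (augmentation_mul_le U) (by omega) (by omega)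
          (invConj_mem_augmentation_pow hnorm _ ha.2) hv.2
      have h5 := mul_mem_augmentation_pow (by omega) (Submodule.sub_mem _ h4 h1) (U.inv_mem ha.1)
      convert h5 using 1
      rw [hTapp, map_sub, map_one, Units.val_mul, Units.val_mul, coe_conj]
      have h6 : (1 : Matrix (Fin n) (Fin n) ℂ) = (a : Matrix (Fin n) (Fin n) ℂ) *
          ((a⁻¹ : GL (Fin n) ℂ) : Matrix (Fin n) (Fin n) ℂ) := by
        rw [← Units.val_mul, mul_inv_cancel, Units.val_one]
      conv_lhs => rw [h6]
      noncomm_ring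
    obtain ⟨w, hw, hwg, hwe⟩ := hgs _ herr
    refine ⟨w * a, mul_mem_congruenceSubgroup hi ⟨hw.1, pow_le_pow_of_mul_le
      (augmentation_mul_le U) hi (Nat.le_succ i) hw.2⟩ ha, ?_, ?_⟩
    · beta_reduce
      rw [Units.val_mul, hwg, ← haF, hinv]
      simp only [Units.val_mul]
    · calc (h⁻¹ * (w * a) * h)⁻¹ * (w * a)
          = (h⁻¹ * a * h)⁻¹ * ((h⁻¹ * w * h)⁻¹ * w) * a := by group
        _ = v := by rw [hwe]; group

/-! ### Connectedness of centralizers in unipotent groups -/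

/-- The curve of complex powers of a unipotent element `u` joins it to `1`. If the curve lies in
`Z`, then `u` is in the identity component of `Z`. -/
theorem mem_identityComponent_of_unipotentPow {Z : Subgroup (GL (Fin n) ℂ)} {u : GL (Fin n) ℂ}
    (hK : ((u : Matrix (Fin n) (Fin n) ℂ) - 1) ^ K = 0)
    (hZ : ∀ t, ∃ g ∈ Z, (g : Matrix (Fin n) (Fin n) ℂ) =
      unipotentPow K ((u : Matrix (Fin n) (Fin n) ℂ) - 1) t) :
    u ∈ identityComponent Z := by
  choose γ hγZ hγ using hZ
  have hγm : ∀ m : ℕ, γ m = u ^ m := fun m => Units.ext (by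
    rw [hγ, unipotentPow_natCast hK]; simp)
  -- Zariski closed sets pull back to zero sets of polynomials in `t`, which are closed in the
  -- Euclidean topology of `ℂ`, so connectedness of `ℂ` can be used.
  have hcont : @Continuous _ _ _ (zariskiTopology n) γ := by
    refine (@continuous_iff_isClosed _ _ _ (zariskiTopology n) γ).2 fun s hs => ?_
    have hs' : IsZariskiClosed s := by
      have h1 : sᶜᶜ ∈ {S : Set (GL (Fin n) ℂ) | IsZariskiClosed S} :=
        (@IsClosed.isOpen_compl _ (zariskiTopology n) s hs)
      rwa [compl_compl] at h1
    obtain ⟨I, rfl⟩ := hs'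
    have h2 : γ ⁻¹' {g : GL (Fin n) ℂ | ∀ p ∈ I,
        MvPolynomial.eval (fun k => (g : Matrix (Fin n) (Fin n) ℂ) k.1 k.2) p = 0} =
        ⋂ p ∈ I, {t | MvPolynomial.eval (fun k =>
          unipotentPow K ((u : Matrix (Fin n) (Fin n) ℂ) - 1) t k.1 k.2) p = 0} := by
      ext t
      simp [hγ]
    rw [h2]
    refine isClosed_biInter fun p _ => ?_
    obtain ⟨q, hq⟩ :=
      exists_polynomial_eval_unipotentPow K ((u : Matrix (Fin n) (Fin n) ℂ) - 1) p
    simp only [← hq]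
    exact isClosed_eq q.continuous continuous_const
  have hpre : @IsPreconnected _ (zariskiTopology n) (Set.range γ) :=
    @isPreconnected_range _ _ _ (zariskiTopology n) _ γ hcont
  have h0 := hγm 0
  have h1 := hγm 1
  rw [Nat.cast_zero, pow_zero] at h0
  rw [Nat.cast_one, pow_one] at h1
  have hsub : Set.range γ ⊆ (Z : Set (GL (Fin n) ℂ)) := by
    rintro _ ⟨t, rfl⟩
    exact hγZ t
  exact (@IsPreconnected.subset_connectedComponentIn _ (zariskiTopology n) _ _ _ hpre
    (Set.mem_range.2 ⟨0, h0⟩) hsub) (Set.mem_range.2 ⟨1, h1⟩)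

/-- In a closed unipotent subgroup of `G`, the centralizer of `h` is connected, hence contained in
`Z_G(h)⁰`. -/
theorem mem_identityComponent_centralizerIn {G : Subgroup (GL (Fin n) ℂ)} (hU : IsAlgebraic U)
    (hUG : U ≤ G) (hK : augmentation U ^ K = ⊥) {u : GL (Fin n) ℂ} (hu : u ∈ U)
    (huh : h⁻¹ * u * h = u) : u ∈ identityComponent (centralizerIn G h) := by
  refine mem_identityComponent_of_unipotentPow (sub_one_pow_eq_zero hK hu) fun t => ?_
  obtain ⟨g, hgU, hg⟩ := exists_mem_unipotentPow hU hu (sub_one_pow_eq_zero hK hu) t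
  refine ⟨g, Subgroup.mem_inf.2 ⟨hUG hgU, Subgroup.mem_centralizer_singleton_iff.2 ?_⟩, hg⟩
  have h1 : Commute (h : Matrix (Fin n) (Fin n) ℂ) u := by
    have h2 : h * u = u * h := by
      calc h * u = h * (h⁻¹ * u * h) := by rw [huh]
        _ = u * h := by group
    have h3 := congrArg (Units.val) h2
    rwa [Units.val_mul, Units.val_mul] at h3
  have h4 := commute_unipotentPow K t (h1.sub_right (Commute.one_right _))
  rw [← hg] at h4
  exact Units.ext (by rw [Units.val_mul, Units.val_mul]; exact h4.eq.symm)

/-! ### The isomorphism of varieties -/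

/-- For a closed unipotent group `U` normalized by `h`, such that `h` centralizes no nontrivial
element of `U`, the map `u ↦ h⁻¹ u⁻¹ h u` is an isomorphism of varieties. -/
theorem exists_isVarietyIso_of_fixedPoints_trivial (hU : IsAlgebraic U)
    (hK : augmentation U ^ K = ⊥) (hnorm : ∀ u ∈ U, h⁻¹ * u * h ∈ U)
    (hfix : ∀ u ∈ U, h⁻¹ * u * h = u → u = 1) :
    ∃ f : U → U, (∀ u : U, (f u : GL (Fin n) ℂ) = (h⁻¹ * (u : GL (Fin n) ℂ)⁻¹ * h) * u) ∧
      IsVarietyIso (X := (U : Set (GL (Fin n) ℂ))) (Y := (U : Set (GL (Fin n) ℂ))) f := by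
  have hconj : ∀ u : GL (Fin n) ℂ, h⁻¹ * u⁻¹ * h * u = (h⁻¹ * u * h)⁻¹ * u := fun u => by group
  have hmem : ∀ u ∈ U, u ∈ congruenceSubgroup U 1 := fun u hu =>
    ⟨hu, by rw [pow_one]; exact sub_one_mem_augmentation hu⟩
  obtain ⟨g, hg, hgs⟩ := exists_isPolyMap_solution hU hK hnorm hfix K 1 le_rfl (by omega)
  obtain ⟨J, hJ, hJinv⟩ := exists_isPolyMap_inv (n := n) K
  choose! r hr hrg hre using hgs
  let f : U → U := fun u => ⟨h⁻¹ * (u : GL (Fin n) ℂ)⁻¹ * h * u,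
    U.mul_mem (hnorm _ (U.inv_mem u.2)) u.2⟩
  let r' : U → U := fun v => ⟨r v, (hr v (hmem v v.2)).1⟩
  have hfr : Function.RightInverse r' f := fun v => Subtype.ext (by
    change h⁻¹ * (r v)⁻¹ * h * r v = v
    rw [hconj]
    exact hre v (hmem v v.2))
  have hinj : Function.Injective f := fun u w huw => Subtype.ext <| by
    refine eq_of_conj_inv_mul_eq hfix u.2 w.2 ?_
    rw [← hconj, ← hconj]
    exact congrArg Subtype.val huw
  refine ⟨f, fun u => rfl, ?_, r', ?_, hfr.leftInverse_of_injective hinj, hfr⟩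
  · refine IsPolyMap.isRegularMap (F := fun x =>
      ((h⁻¹ : GL (Fin n) ℂ) : Matrix (Fin n) (Fin n) ℂ) * J x * h * x)
      ((((isPolyMap_const _).mul hJ).mul (isPolyMap_const _)).mul isPolyMap_id) fun u => ?_
    change ((h⁻¹ * (u : GL (Fin n) ℂ)⁻¹ * h * u : GL (Fin n) ℂ) : Matrix (Fin n) (Fin n) ℂ) = _
    rw [hJinv _ (sub_one_pow_eq_zero hK u.2)]
    simp only [Units.val_mul]
  · exact IsPolyMap.isRegularMap hg fun v => hrg v (hmem v v.2)

end LinAlgGroup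

theorem lemma4p1 (n : ℕ) (G P H U : Subgroup (Matrix.GeneralLinearGroup (Fin n) ℂ))
    (hG : LinAlgGroup.IsReductive G)
    (hP : LinAlgGroup.IsParabolic P G)
    (hH : LinAlgGroup.IsLevi H P)
    (hU : LinAlgGroup.IsUnipotentRadical U P)
    (h : Matrix.GeneralLinearGroup (Fin n) ℂ) (hh : h ∈ H)
    (hZ : LinAlgGroup.identityComponent (LinAlgGroup.centralizerIn G h) ⊆
      (H : Set (Matrix.GeneralLinearGroup (Fin n) ℂ))) :
    (∃ f : U → U,
      (∀ u : U, (f u : Matrix.GeneralLinearGroup (Fin n) ℂ) =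
        (h⁻¹ * (u : Matrix.GeneralLinearGroup (Fin n) ℂ)⁻¹ * h) * u) ∧
      LinAlgGroup.IsVarietyIso
        (X := (U : Set (Matrix.GeneralLinearGroup (Fin n) ℂ)))
        (Y := (U : Set (Matrix.GeneralLinearGroup (Fin n) ℂ))) f) ∧
    ∀ u' ∈ U, ∃! u : Matrix.GeneralLinearGroup (Fin n) ℂ, u ∈ U ∧ h * u' = u⁻¹ * h * u := by
  obtain ⟨hHP, -, U', hU', hHU, -⟩ := hH
  obtain rfl : U' = U := hU'.unique hU
  obtain ⟨⟨hUP, hUnormal, hUalg, -, hUuni⟩, -⟩ := hU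
  obtain ⟨K, hK⟩ := hUuni.exists_augmentation_pow_eq_bot
  have hnorm : ∀ u ∈ U', h⁻¹ * u * h ∈ U' := by
    intro u hu
    have h1 := hUnormal.conj_mem ⟨u, hUP hu⟩ (Subgroup.mem_subgroupOf.2 hu) ⟨h⁻¹, P.inv_mem (hHP hh)⟩
    rw [Subgroup.mem_subgroupOf] at h1
    simpa using h1
  have hfix : ∀ u ∈ U', h⁻¹ * u * h = u → u = 1 := by
    intro u hu huh
    have h1 := hZ (LinAlgGroup.mem_identityComponent_centralizerIn hUalg (hUP.trans hP.1) hK hu huh)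
    exact Subgroup.mem_bot.1 (hHU ▸ Subgroup.mem_inf.2 ⟨h1, hu⟩)
  obtain ⟨f, hf, hiso⟩ :=
    LinAlgGroup.exists_isVarietyIso_of_fixedPoints_trivial hUalg hK hnorm hfix
  refine ⟨⟨f, hf, hiso⟩, fun u' hu' => ?_⟩
  obtain ⟨-, r, -, hrf, hfr⟩ := hiso
  have hiff : ∀ u : U', h * u' = (u : Matrix.GeneralLinearGroup (Fin n) ℂ)⁻¹ * h * u ↔
      f u = ⟨u', hu'⟩ := by
    intro u
    rw [Subtype.ext_iff, hf, eq_comm, mul_assoc h⁻¹, mul_assoc h⁻¹, inv_mul_eq_iff_eq_mul]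
  refine ⟨r ⟨u', hu'⟩, ⟨(r ⟨u', hu'⟩).2, (hiff _).2 (hfr _)⟩, ?_⟩
  rintro u ⟨hu, hue⟩
  rw [← (hiff ⟨u, hu⟩).1 hue]
  exact (congrArg Subtype.val (hrf ⟨u, hu⟩)).symm
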